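/- Let $\kappa$ be an uncountable regular cardinal. For a set $S$, let $\Sigma_\kappa(S)=\{x\in[0,1]^S : |\{s\in S : x(s)\neq 0\}|<\kappa\}$, endowed with the topology of pointwise convergence (the subspace topology from the product $[0,1]^S$). A compact space is called $\kappa$-Corson if it is homeomorphic to a subspace of $\Sigma_\kappa(S)$ for some set $S$. If $K$ is a $\kappa$-Corson compact space, $L$ is a Hausdorff topological space and $f\colon K\to L$ is a continuous surjection, then $L$ is a $\kappa$-Corson compact space. -/

import Mathlib

universe u

/-- The `κ`-sigma-product `Σ_κ(S)`: the points of the cube `[0,1]^S` whose support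
`{s | x s ≠ 0}` has cardinality `< κ`. Coerced to a type, it carries the subspace topology
of the product topology (the topology of pointwise convergence). -/
def sigmaProduct (κ : Cardinal.{u}) (S : Type u) : Set (S → unitInterval) :=
  {x | Cardinal.mk {s : S // x s ≠ 0} < κ}

/-- A topological space `K` is a `κ`-Corson compact space if it is compact and embeds
topologically into `Σ_κ(S)` for some set `S`. -/
def IsCorsonCompact (κ : Cardinal.{u}) (K : Type u) [TopologicalSpace K] : Prop :=
  CompactSpace K ∧
    ∃ (S : Type u) (e : K → sigmaProduct κ S), Topology.IsEmbedding e

open Set Topology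

/-! View `K` in a cube. By an elementary-submodel style argument on the fibre product of `f`,
restricting points to suitably closed coordinate sets gives retractions `ρ X` of `K` that respect
the fibres of `f` (`exists_isFibreRetraction`). It suffices to find continuous functions, constant
on fibres, fewer than `κ` nonzero at each point, whose joint kernel is that of `f`. Such a family
for `f ∘ ρ X` is built by induction on the cardinality of `X`. Below `κ`, fewer than `κ` functions
separate points, so supports are no issue. Otherwise `X` is exhausted by a well-ordered chain of
smaller sets, and the functions are increments along it; a point has few nonzero increments because
its support meets few of the successive differences. `X = univ` gives the theorem. -/

/-- The least set containing `X` and, with every finite subset `F`, also `φ F`. -/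
inductive FinClosure {S : Type u} (φ : Finset S → Set S) (X : Set S) : S → Prop
  | base (s : S) (hs : s ∈ X) : FinClosure φ X s
  | step (F : Finset S) (hF : ∀ s ∈ F, FinClosure φ X s) (t : S) (ht : t ∈ φ F) : FinClosure φ X t

/-- The closure of `X` under `φ`, as a set. -/
def finClosure {S : Type u} (φ : Finset S → Set S) (X : Set S) : Set S := {s | FinClosure φ X s}

/-! ### Closing a set under a finitary set mapping -/

section FinClosure

variable {S : Type u} {φ : Finset S → Set S} {X Y : Set S}

lemma subset_finClosure : X ⊆ finClosure φ X := fun s hs => FinClosure.base s hs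

lemma finClosure_closed (F : Finset S) (hF : ↑F ⊆ finClosure φ X) : φ F ⊆ finClosure φ X :=
  fun t ht => FinClosure.step F (fun _ hs => hF hs) t ht

lemma finClosure_subset {A : Set S} (hX : X ⊆ A)
    (hA : ∀ F : Finset S, ↑F ⊆ A → φ F ⊆ A) : finClosure φ X ⊆ A := by
  intro s hs
  induction hs with
  | base s hs => exact hX hs
  | step F _ t ht ih => exact hA F ih ht

lemma finClosure_mono (h : X ⊆ Y) : finClosure φ X ⊆ finClosure φ Y :=
  finClosure_subset (h.trans subset_finClosure) finClosure_closed

lemma exists_finset_of_mem_finClosure {s : S} (hs : s ∈ finClosure φ X) :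
    ∃ F : Finset S, ↑F ⊆ X ∧ s ∈ finClosure φ (F : Set S) := by
  classical
  induction hs with
  | base s hs => exact ⟨{s}, by simpa using hs, subset_finClosure (by simp)⟩
  | step F _ t ht ih =>
    choose! G hGX hG using ih
    refine ⟨F.biUnion G, ?_, ?_⟩
    · intro x hx
      obtain ⟨a, ha, hx⟩ := Finset.mem_biUnion.1 (Finset.mem_coe.1 hx)
      exact hGX a ha hx
    · refine finClosure_closed F (fun a ha => ?_) ht
      refine finClosure_mono ?_ (hG a ha)
      exact_mod_cast Finset.subset_biUnion_of_mem G ha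

lemma mk_finset_lt {κ : Cardinal.{u}} (hκ : Cardinal.aleph0 < κ) {α : Type u}
    (hα : Cardinal.mk α < κ) : Cardinal.mk (Finset α) < κ := by
  cases finite_or_infinite α
  · exact (Cardinal.lt_aleph0_of_finite _).trans hκ
  · rwa [Cardinal.mk_finset_of_infinite]

lemma mk_iUnion_nat_lt {κ : Cardinal.{u}} (hκ : Cardinal.aleph0 < κ) (hreg : κ.IsRegular)
    {A : ℕ → Set S} (hA : ∀ n, Cardinal.mk (A n) < κ) : Cardinal.mk (⋃ n, A n) < κ := by
  have h : (⋃ n, A n) = ⋃ n : ULift.{u} ℕ, A n.down := by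
    ext s; simp
  rw [h]
  exact (Cardinal.card_iUnion_lt_iff_forall_of_isRegular hreg (by simpa using hκ)).2
    fun n => hA n.down

/-- Countably many rounds suffice, since a finite subset of the union lies in one stage; regularity
keeps each stage small. -/
lemma mk_finClosure_lt {κ : Cardinal.{u}} (hκ : Cardinal.aleph0 < κ) (hreg : κ.IsRegular)
    (hφ : ∀ F, Cardinal.mk (φ F) < κ) (hX : Cardinal.mk X < κ) :
    Cardinal.mk (finClosure φ X) < κ := by
  classical
  let next : Set S → Set S := fun A => A ∪ ⋃ F : Finset A, φ (F.map (Function.Embedding.subtype _))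
  let A : ℕ → Set S := fun n => next^[n] X
  have hsucc (n : ℕ) : A (n + 1) = next (A n) := Function.iterate_succ_apply' _ _ _
  have hmono : Monotone A := monotone_nat_of_le_succ fun n => by
    rw [hsucc]; exact subset_union_left
  have hcard (n : ℕ) : Cardinal.mk (A n) < κ := by
    induction n with
    | zero => exact hX
    | succ n ih =>
      rw [hsucc]
      refine (Cardinal.mk_union_le _ _).trans_lt (Cardinal.add_lt_of_lt hκ.le ih ?_)
      exact (Cardinal.card_iUnion_lt_iff_forall_of_isRegular hreg (mk_finset_lt hκ ih)).2
        fun F => hφ _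
  refine (Cardinal.mk_le_mk_of_subset (finClosure_subset (A := ⋃ n, A n) ?_ ?_)).trans_lt
    (mk_iUnion_nat_lt hκ hreg hcard)
  · exact subset_iUnion A 0
  · intro F hF
    obtain ⟨n, hn⟩ : ∃ n, ↑F ⊆ A n :=
      hmono.directed_le.exists_mem_subset_of_finset_subset_biUnion hF
    refine subset_iUnion_of_subset (n + 1) ?_
    rw [hsucc]
    refine subset_union_of_subset_right ?_ _
    have : (F.subtype (· ∈ A n)).map (Function.Embedding.subtype _) = F :=
      Finset.subtype_map_of_mem fun x hx => hn hx
    refine subset_iUnion_of_subset (F.subtype (· ∈ A n)) ?_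
    rw [this]

end FinClosure

/-! ### Restricting points of a power to a set of coordinates -/

section Indicator

variable {S Z : Type*}

lemma extend_restrict_eq_indicator [Zero Z] (A : Set S) (x : S → Z) :
    Function.extend (Subtype.val : A → S) (fun a : A => x a) 0 = A.indicator x := by
  funext s
  by_cases hs : s ∈ A
  · rw [indicator_of_mem hs]
    exact Subtype.val_injective.extend_apply (fun a : A => x a) 0 ⟨s, hs⟩
  · rw [indicator_of_notMem hs, Function.extend_apply' _ _ _ (by rintro ⟨a, rfl⟩; exact hs a.2)]
    rfl

variable [TopologicalSpace Z]

/-- An open set of a power contains, around each of its points, an open set which depends on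
finitely many coordinates only. -/
lemma IsOpen.exists_finset_restrict {O : Set (S → Z)} (hO : IsOpen O) {x : S → Z} (hx : x ∈ O) :
    ∃ (F : Finset S) (W : Set (F → Z)), IsOpen W ∧ (fun s : F => x s) ∈ W ∧
      ∀ y, (fun s : F => y s) ∈ W → y ∈ O := by
  obtain ⟨F, U, hU, hFU⟩ := isOpen_pi_iff.1 hO x hx
  refine ⟨F, univ.pi fun s => U s, isOpen_set_pi finite_univ fun s _ => (hU s s.2).1, ?_, ?_⟩
  · exact fun s _ => (hU s s.2).2
  · exact fun y hy => hFU fun s hs => hy ⟨s, hs⟩ trivial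

/-- Extension by zero from `A` to `S` is continuous. -/
lemma continuous_extend_zero [Zero Z] (A : Set S) :
    Continuous fun (w : A → Z) => Function.extend (Subtype.val : A → S) w 0 := by
  refine continuous_pi fun s => ?_
  by_cases hs : s ∈ A
  · have : (fun w : A → Z => Function.extend (Subtype.val : A → S) w 0 s) = fun w => w ⟨s, hs⟩ := by
      funext w
      exact Subtype.val_injective.extend_apply w 0 ⟨s, hs⟩
    rw [this]
    exact continuous_apply _
  · have : (fun w : A → Z => Function.extend (Subtype.val : A → S) w 0 s) = fun w => 0 := by
      funext w
      rw [Function.extend_apply' _ _ _ (by rintro ⟨a, rfl⟩; exact hs a.2)]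
      rfl
    rw [this]
    exact continuous_const

/-- An open set around `A.indicator x` contains `A.indicator y` for all `y` that are close to `x`
on a suitable finite subset of `A`. -/
lemma IsOpen.exists_finset_restrict_indicator [Zero Z] {O : Set (S → Z)} (hO : IsOpen O) (A : Set S)
    {x : S → Z} (hx : A.indicator x ∈ O) :
    ∃ (F : Finset A) (W : Set (F → Z)), IsOpen W ∧ (fun s : F => x s) ∈ W ∧
      ∀ y : S → Z, (fun s : F => y s) ∈ W → A.indicator y ∈ O := by
  obtain ⟨F, W, hW, hxW, h⟩ := (hO.preimage (continuous_extend_zero A)).exists_finset_restrict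
    (x := fun a : A => x a) (by rwa [mem_preimage, extend_restrict_eq_indicator])
  refine ⟨F, W, hW, hxW, fun y hy => ?_⟩
  have := h (fun a => y a) hy
  rwa [mem_preimage, extend_restrict_eq_indicator] at this

end Indicator

/-! ### Retractions that respect the fibres -/

/-- If all points of a closed set `R` in a power of a second countable space have support smaller
than `κ`, then `R` is stable under restriction to every set that is closed under a suitable
set mapping with values smaller than `κ`. -/
lemma exists_setMapping_indicator_mem {S : Type u} {Z : Type*} [TopologicalSpace Z]
    [SecondCountableTopology Z] [Zero Z] {κ : Cardinal.{u}} (hκ : Cardinal.aleph0 < κ)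
    (hreg : κ.IsRegular) {R : Set (S → Z)} (hR : IsClosed R)
    (hsupp : ∀ p ∈ R, Cardinal.mk (Function.support p) < κ) :
    ∃ φ : Finset S → Set S, (∀ F, Cardinal.mk (φ F) < κ) ∧
      ∀ A : Set S, (∀ F : Finset S, ↑F ⊆ A → φ F ⊆ A) → ∀ p ∈ R, A.indicator p ∈ R := by
  classical
  have key (F : Finset S) : ∃ D : Set R, D.Countable ∧
      ∀ p ∈ R, ∀ W : Set (F → Z), IsOpen W → (fun s : F => p s) ∈ W → ∃ d ∈ D, (fun s : F => d.1 s) ∈ W := by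
    let g : R → F → Z := fun p s => p.1 s
    obtain ⟨D, hDc, hD⟩ := TopologicalSpace.exists_countable_dense (range g)
    choose c hc using fun q : range g => q.2
    refine ⟨c '' D, hDc.image c, fun p hp W hW hpW => ?_⟩
    obtain ⟨q, hqD, hqW⟩ := hD.exists_mem_open (hW.preimage continuous_subtype_val)
      ⟨⟨g ⟨p, hp⟩, mem_range_self _⟩, hpW⟩
    refine ⟨c q, mem_image_of_mem c hqD, ?_⟩
    have hq : (fun s : F => (c q).1 s) = q.1 := hc q
    rw [hq]
    exact hqW
  choose D hDc hD using key
  -- `D F` approximates `R` on `F`. If `A` is closed, members of `D F` with `F ⊆ A` are supported in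
  -- `A`, so they approximate `A.indicator p` itself.
  refine ⟨fun F => ⋃ d ∈ D F, Function.support d.1, fun F => ?_, fun A hA p hp => ?_⟩
  · obtain h | h := (D F).eq_empty_or_nonempty
    · simp [h, hreg.pos]
    · obtain ⟨d, hd⟩ := (hDc F).exists_eq_range h
      simp only [hd, biUnion_range]
      exact mk_iUnion_nat_lt hκ hreg fun n => hsupp _ (d n).2
  · rw [← hR.closure_eq, mem_closure_iff]
    intro O hO hpO
    obtain ⟨F, W, hW, hpW, h⟩ := hO.exists_finset_restrict_indicator A hpO
    let F' : Finset S := F.map (Function.Embedding.subtype _)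
    have hF' (s : F) : s.1.1 ∈ F' := Finset.mem_map_of_mem _ s.2
    have hF'A : ↑F' ⊆ A := by
      intro s hs
      obtain ⟨a, -, rfl⟩ := Finset.mem_map.1 (Finset.mem_coe.1 hs)
      exact a.2
    let r : (F' → Z) → F → Z := fun w s => w ⟨s.1.1, hF' s⟩
    have hr : Continuous r := continuous_pi fun s => continuous_apply _
    obtain ⟨d, hd, hdW⟩ := hD F' p hp (r ⁻¹' W) (hW.preimage hr) hpW
    refine ⟨d.1, ?_, d.2⟩
    have hdA : Function.support d.1 ⊆ A :=
      (subset_biUnion_of_mem (u := fun d : R => Function.support d.1) hd).trans (hA F' hF'A)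
    have := h d.1 hdW
    rwa [indicator_eq_self.2 hdA] at this

/-- `ρ X` is the retraction of `K` that restricts points (viewed in a cube via `e`) to the
`φ`-closure of `X`, and it maps fibres of `f` into fibres of `f`. -/
structure IsFibreRetraction {K L S : Type u} (e : K → S → unitInterval) (f : K → L)
    (φ : Finset S → Set S) (ρ : Set S → K → K) : Prop where
  apply_eq : ∀ X x, e (ρ X x) = (finClosure φ X).indicator (e x)
  fibre : ∀ X x y, f x = f y → f (ρ X x) = f (ρ X y)

/-- The fibre product of `f` is closed, hence so is its image `R` in a power of the square.
Stability of `R` under restriction handles both points of a pair at once. -/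
lemma exists_isFibreRetraction {K L S : Type u} [TopologicalSpace K] [CompactSpace K]
    [TopologicalSpace L] [T2Space L] {κ : Cardinal.{u}} (hκ : Cardinal.aleph0 < κ)
    (hreg : κ.IsRegular) {e : K → S → unitInterval} (he : IsEmbedding e)
    (hsupp : ∀ x, Cardinal.mk (Function.support (e x)) < κ) {f : K → L} (hf : Continuous f) :
    ∃ (φ : Finset S → Set S) (ρ : Set S → K → K), (∀ F, Cardinal.mk (φ F) < κ) ∧
      IsFibreRetraction e f φ ρ := by
  let g : K × K → S → unitInterval × unitInterval := fun q s => (e q.1 s, e q.2 s)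
  have hg : Continuous g := by
    have := he.continuous
    fun_prop
  let R : Set (S → unitInterval × unitInterval) := g '' {q | f q.1 = f q.2}
  have hR : IsClosed R :=
    ((isClosed_eq (hf.comp continuous_fst) (hf.comp continuous_snd)).isCompact.image hg).isClosed
  have hRsupp : ∀ p ∈ R, Cardinal.mk (Function.support p) < κ := by
    rintro _ ⟨q, -, rfl⟩
    have : Function.support (g q) ⊆ Function.support (e q.1) ∪ Function.support (e q.2) := by
      intro s hs
      by_contra h
      simp only [mem_union, Function.mem_support, not_or, not_not] at h
      exact hs (Prod.ext h.1 h.2)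
    exact (Cardinal.mk_le_mk_of_subset this).trans_lt ((Cardinal.mk_union_le _ _).trans_lt
      (Cardinal.add_lt_of_lt hκ.le (hsupp _) (hsupp _)))
  obtain ⟨φ, hφ, hφR⟩ := exists_setMapping_indicator_mem hκ hreg hR hRsupp
  have key (X : Set S) (x y : K) (hxy : f x = f y) : ∃ x' y', f x' = f y' ∧
      e x' = (finClosure φ X).indicator (e x) ∧ e y' = (finClosure φ X).indicator (e y) := by
    obtain ⟨q, hq, hqe⟩ := hφR (finClosure φ X) finClosure_closed (g (x, y))
      (mem_image_of_mem g (show f x = f y from hxy))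
    refine ⟨q.1, q.2, hq, ?_, ?_⟩ <;> funext s <;> have := congrFun hqe s <;>
      by_cases hs : s ∈ finClosure φ X <;> simp_all [g, Prod.ext_iff]
  choose ρ hρ using fun X x => (key X x x rfl).imp fun x' h => h.choose_spec.2.1
  refine ⟨φ, ρ, hφ, hρ, fun X x y hxy => ?_⟩
  obtain ⟨x', y', h, hx, hy⟩ := key X x y hxy
  rwa [he.injective ((hρ X x).trans hx.symm), he.injective ((hρ X y).trans hy.symm)]

namespace IsFibreRetraction

variable {K L S : Type u} {e : K → S → unitInterval} {f : K → L} {φ : Finset S → Set S}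
  {ρ : Set S → K → K}

lemma comp_of_subset (h : IsFibreRetraction e f φ ρ) (he : Function.Injective e) {X Y : Set S}
    (hXY : X ⊆ Y) (x : K) : ρ X (ρ Y x) = ρ X x := by
  apply he
  rw [h.apply_eq, h.apply_eq, h.apply_eq, indicator_indicator,
    inter_eq_left.2 (finClosure_mono hXY)]

lemma eq_of_subset (h : IsFibreRetraction e f φ ρ) (he : Function.Injective e) {X Y : Set S}
    (hXY : X ⊆ Y) {x y : K} (hY : f (ρ Y x) = f (ρ Y y)) : f (ρ X x) = f (ρ X y) := by
  rw [← h.comp_of_subset he hXY x, ← h.comp_of_subset he hXY y]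
  exact h.fibre X _ _ hY

lemma univ_apply (h : IsFibreRetraction e f φ ρ) (he : Function.Injective e) (x : K) :
    ρ univ x = x := by
  apply he
  rw [h.apply_eq, univ_subset_iff.1 subset_finClosure, indicator_univ]

variable [TopologicalSpace K]

lemma continuous (h : IsFibreRetraction e f φ ρ) (he : IsEmbedding e) (X : Set S) :
    Continuous (ρ X) := by
  rw [he.continuous_iff]
  refine continuous_pi fun s => ?_
  have : (fun x => e (ρ X x) s) = fun x => (finClosure φ X).indicator (e x) s := by
    simp only [h.apply_eq]
  refine (this ▸ ?_ : Continuous fun x => e (ρ X x) s)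
  by_cases hs : s ∈ finClosure φ X
  · simpa [hs] using continuous_pi_iff.1 he.continuous s
  · simpa [hs] using continuous_const

/-- Each coordinate is eventually constant, because membership in the closure has a finite witness.
-/
lemma tendsto_finset (h : IsFibreRetraction e f φ ρ) (he : IsEmbedding e) (X : Set S) (x : K) :
    Filter.Tendsto (fun F : Finset X => ρ (Subtype.val '' (F : Set X)) x) Filter.atTop
      (𝓝 (ρ X x)) := by
  classical
  rw [he.tendsto_nhds_iff, tendsto_pi_nhds]
  intro s
  simp only [Function.comp_apply, h.apply_eq]
  refine tendsto_const_nhds.congr' ?_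
  by_cases hs : s ∈ finClosure φ X
  · obtain ⟨F₀, hF₀, hsF⟩ := exists_finset_of_mem_finClosure hs
    filter_upwards [Filter.eventually_ge_atTop (F₀.subtype (· ∈ X))] with F hF
    have : s ∈ finClosure φ (Subtype.val '' (F : Set X)) :=
      by
      refine finClosure_mono (fun t ht => ?_) hsF
      exact ⟨⟨t, hF₀ ht⟩, hF (by simpa using ht), rfl⟩
    rw [indicator_of_mem hs, indicator_of_mem this]
  · refine .of_forall fun F => ?_
    dsimp only
    have : s ∉ finClosure φ (Subtype.val '' (F : Set X)) := fun hF =>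
      hs (finClosure_mono (by rintro _ ⟨t, -, rfl⟩; exact t.2) hF)
    rw [indicator_of_notMem hs, indicator_of_notMem this]

lemma eq_of_forall_finset [TopologicalSpace L] [T2Space L] (h : IsFibreRetraction e f φ ρ) (he : IsEmbedding e)
    (hf : Continuous f) {X : Set S} {x y : K}
    (hF : ∀ F : Set S, F.Finite → F ⊆ X → f (ρ F x) = f (ρ F y)) : f (ρ X x) = f (ρ X y) := by
  refine tendsto_nhds_unique ((hf.tendsto _).comp (h.tendsto_finset he X x)) ?_
  refine ((hf.tendsto _).comp (h.tendsto_finset he X y)).congr fun F => ?_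
  exact (hF _ (F.finite_toSet.image _) (by rintro _ ⟨t, -, rfl⟩; exact t.2)).symm

end IsFibreRetraction

/-! ### Separating families, by induction on cardinality -/

/-- A family of continuous functions `K → [-1, 1]` that are constant on the fibres of `f`, less
than `κ` of which are nonzero at any given point, and whose joint kernel is contained in the
kernel of `f ∘ r`. -/
structure IsSeparatingFamily {K L T : Type u} [TopologicalSpace K] (κ : Cardinal.{u}) (f : K → L)
    (r : K → K) (h : T → K → ℝ) : Prop where
  continuous : ∀ t, Continuous (h t)
  abs_le : ∀ t x, |h t x| ≤ 1
  fibre : ∀ t x y, f x = f y → h t x = h t y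
  support : ∀ x, Cardinal.mk {t // h t x ≠ 0} < κ
  separates : ∀ x y, (∀ t, h t x = h t y) → f (r x) = f (r y)

section

variable {K L S : Type u} [TopologicalSpace K] [TopologicalSpace L] [T2Space L]
  {κ : Cardinal.{u}} {e : K → S → unitInterval} {f : K → L} {φ : Finset S → Set S}
  {ρ : Set S → K → K}

lemma exists_isSeparatingFamily_of_lt [CompactSpace K] (hκ : Cardinal.aleph0 < κ)
    (hreg : κ.IsRegular)
    (he : IsEmbedding e) (hf : Continuous f) (hsurj : Function.Surjective f)
    (hφ : ∀ F, Cardinal.mk (φ F) < κ) (hρ : IsFibreRetraction e f φ ρ) {X : Set S}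
    (hX : Cardinal.mk X < κ) :
    ∃ (T : Type u) (h : T → K → ℝ), IsSeparatingFamily κ f (ρ X) h := by
  classical
  have : CompactSpace L := hsurj.compactSpace hf
  set A := finClosure φ X with hA
  have hAκ : Cardinal.mk A < κ := mk_finClosure_lt hκ hreg hφ hX
  let B (F : Finset A) := TopologicalSpace.countableBasis (F → unitInterval)
  let N := Σ F : Finset A, ULift.{u} (B F)
  have hN : Cardinal.mk N < κ := by
    rw [Cardinal.mk_sigma]
    refine Cardinal.sum_lt_of_isRegular hreg (mk_finset_lt hκ hAκ) fun F => ?_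
    refine lt_of_le_of_lt ?_ hκ
    have : Countable (B F) := TopologicalSpace.countable_countableBasis _
    exact Cardinal.mk_le_aleph0
  let box (n : N) : Set K := {x | (fun s : n.1 => e x s) ∈ n.2.down.1}
  have hbox (x : K) {O : Set K} (hO : IsOpen O) (hx : ρ X x ∈ O) :
      ∃ n, x ∈ box n ∧ ∀ y ∈ box n, ρ X y ∈ O := by
    obtain ⟨O', hO', rfl⟩ := he.isOpen_iff.1 hO
    rw [mem_preimage, hρ.apply_eq] at hx
    obtain ⟨F, W, hW, hxW, hWO⟩ := hO'.exists_finset_restrict_indicator _ hx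
    obtain ⟨V, hV, hxV, hVW⟩ :=
      (TopologicalSpace.isBasis_countableBasis (F → unitInterval)).exists_subset_of_mem_open hxW hW
    refine ⟨⟨F, ⟨V, hV⟩⟩, hxV, fun y hy => ?_⟩
    rw [mem_preimage, hρ.apply_eq]
    exact hWO _ (hVW hy)
  -- One function is chosen per pair of boxes that some function separates; Urysohn's lemma provides
  -- such a pair around any two points to be separated.
  let good (n : N × N) (g : L → ℝ) : Prop := Continuous g ∧ (∀ z, |g z| ≤ 1) ∧
    ∀ x ∈ box n.1, ∀ y ∈ box n.2, g (f (ρ X x)) ≠ g (f (ρ X y))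
  let g (n : N × N) : L → ℝ := if h : ∃ g, good n g then h.choose else 0
  have hg (n : N × N) : Continuous (g n) ∧ (∀ z, |g n z| ≤ 1) := by
    by_cases h : ∃ g, good n g
    · have := h.choose_spec
      simp only [g, dif_pos h]
      exact ⟨this.1, this.2.1⟩
    · simp only [g, dif_neg h]
      exact ⟨continuous_const, by simp⟩
  refine ⟨N × N, fun n x => g n (f (ρ X x)), ?_, ?_, ?_, ?_, ?_⟩
  · exact fun n => (hg n).1.comp (hf.comp (hρ.continuous he X))
  · exact fun n x => (hg n).2 _
  · intro n x y hxy
    simp only [hρ.fibre X x y hxy]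
  · intro x
    refine (Cardinal.mk_subtype_le _).trans_lt ?_
    rw [Cardinal.mk_prod, Cardinal.lift_id]
    exact Cardinal.mul_lt_of_lt hκ.le hN hN
  · intro x y hxy
    by_contra hne
    obtain ⟨u, hu0, hu1, hu⟩ := exists_continuous_zero_one_of_isClosed
      (isClosed_singleton (x := f (ρ X x))) (isClosed_singleton (x := f (ρ X y)))
      (disjoint_singleton.2 hne)
    have hux : u (f (ρ X x)) = 0 := hu0 rfl
    have huy : u (f (ρ X y)) = 1 := hu1 rfl
    obtain ⟨n, hxn, hn⟩ := hbox x (O := {z | u (f z) < 1 / 2})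
      (isOpen_lt (u.continuous.comp hf) continuous_const) (by simp [hux])
    obtain ⟨m, hym, hm⟩ := hbox y (O := {z | 1 / 2 < u (f z)})
      (isOpen_lt continuous_const (u.continuous.comp hf)) (by simp [huy]; norm_num)
    have hex : ∃ g, good (n, m) g := by
      refine ⟨u, u.continuous, fun z => ?_, fun x hx y hy => ?_⟩
      · rw [abs_of_nonneg (hu z).1]
        exact (hu z).2
      · exact ((hn x hx : _ < _).trans (hm y hy)).ne
    have := hxy (n, m)
    simp only [g, dif_pos hex] at this
    exact hex.choose_spec.2.2 x hxn y hym this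

lemma exists_isSeparatingFamily_of_forall_lt (hκ : Cardinal.aleph0 < κ) (hreg : κ.IsRegular)
    (he : IsEmbedding e) (hsupp : ∀ x, Cardinal.mk (Function.support (e x)) < κ)
    (hf : Continuous f) (hρ : IsFibreRetraction e f φ ρ) {X : Set S}
    (hX : Cardinal.aleph0 ≤ Cardinal.mk X)
    (ih : ∀ Y : Set S, Cardinal.mk Y < Cardinal.mk X →
      ∃ (T : Type u) (h : T → K → ℝ), IsSeparatingFamily κ f (ρ Y) h) :
    ∃ (T : Type u) (h : T → K → ℝ), IsSeparatingFamily κ f (ρ X) h := by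
  classical
  let I := (Cardinal.mk X).ord.ToType
  obtain ⟨v⟩ : Nonempty (I ≃ X) := Cardinal.eq.1 (Cardinal.mk_ord_toType _)
  let w : I → S := fun i => v i
  let lo (i : I) : Set S := w '' Iio i
  let hi (i : I) : Set S := w '' Iic i
  have hlohi (i : I) : lo i ⊆ hi i := image_mono Iio_subset_Iic_self
  have hhilo {i j : I} (hij : i < j) : hi i ⊆ lo j := image_mono fun k hk => lt_of_le_of_lt hk hij
  have hhicard (i : I) : Cardinal.mk (hi i) < Cardinal.mk X := by
    have h : hi i = insert (w i) (lo i) := by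
      simp only [hi, lo, ← Iio_insert, image_insert_eq]
    rw [h]
    refine (Cardinal.mk_insert_le).trans_lt (Cardinal.add_lt_of_lt hX ?_ ?_)
    · refine Cardinal.mk_image_le.trans_lt ?_
      simpa [I] using Cardinal.mk_Iio_lt i (by simp [I])
    · exact Cardinal.one_lt_aleph0.trans_le hX
  obtain ⟨T₀, h₀, H₀⟩ := ih ∅ (by
    rw [Cardinal.mk_eq_zero]; exact Cardinal.aleph0_pos.trans_le hX)
  choose T h H using fun i => ih (hi i) (hhicard i)
  let T' := T₀ ⊕ Σ i, T i
  -- `h₀` starts the induction at `∅`; halving keeps the increments in `[-1, 1]`.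
  let h' : T' → K → ℝ := Sum.elim h₀ fun p x =>
    (h p.1 p.2 (ρ (hi p.1) x) - h p.1 p.2 (ρ (lo p.1) x)) / 2
  refine ⟨T', h', ?_, ?_, ?_, ?_, ?_⟩
  · rintro (t | ⟨i, t⟩)
    · exact H₀.continuous t
    · exact ((((H i).continuous t).comp (hρ.continuous he _)).sub
        (((H i).continuous t).comp (hρ.continuous he _))).div_const 2
  · rintro (t | ⟨i, t⟩) x
    · exact H₀.abs_le t x
    · have h1 := abs_le.1 ((H i).abs_le t (ρ (hi i) x))
      have h2 := abs_le.1 ((H i).abs_le t (ρ (lo i) x))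
      simp only [h', Sum.elim_inr]
      rw [abs_le]
      constructor <;> linarith
  · rintro (t | ⟨i, t⟩) x y hxy
    · exact H₀.fibre t x y hxy
    · simp only [h', Sum.elim_inr]
      rw [(H i).fibre t _ _ (hρ.fibre (hi i) x y hxy), (H i).fibre t _ _ (hρ.fibre (lo i) x y hxy)]
  · intro x
    -- Only these `i` contribute increments. Each needs a support point of `x` new at stage `i`, and
    -- distinct stages give distinct points.
    let J : Set I := {i | ρ (hi i) x ≠ ρ (lo i) x}
    have hJ : Cardinal.mk J < κ := by
      have key (i : J) : ∃ s : Function.support (e x),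
          s.1 ∈ finClosure φ (hi i) ∧ s.1 ∉ finClosure φ (lo i) := by
        by_contra! hcon
        refine i.2 (he.injective ?_)
        rw [hρ.apply_eq, hρ.apply_eq]
        funext s
        by_cases hs : e x s = 0
        · simp [indicator_apply, hs]
        · have : s ∈ finClosure φ (hi i) ↔ s ∈ finClosure φ (lo i) :=
            ⟨hcon ⟨s, hs⟩, fun h => finClosure_mono (hlohi i) h⟩
          simp [indicator_apply, this]
      choose s hs1 hs2 using key
      have hlt {i j : J} (hij : i < j) : s i ≠ s j := fun h =>
        hs2 j (h ▸ finClosure_mono (hhilo hij) (hs1 i))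
      have hinj : Function.Injective s := fun i j hij => by
        by_contra hne
        rcases lt_or_gt_of_ne hne with h | h
        · exact hlt h hij
        · exact hlt h hij.symm
      exact (Cardinal.mk_le_of_injective hinj).trans_lt (hsupp x)
    let P (i : J) : Set (T i) := {t | h i t (ρ (hi i) x) ≠ 0} ∪ {t | h i t (ρ (lo i) x) ≠ 0}
    have hP (i : J) : Cardinal.mk (P i) < κ :=
      (Cardinal.mk_union_le _ _).trans_lt
        (Cardinal.add_lt_of_lt hκ.le ((H i).support _) ((H i).support _))
    have hsub : {t | h' t x ≠ 0} ⊆ Sum.inl '' {t | h₀ t x ≠ 0} ∪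
        ⋃ i : J, (fun t => Sum.inr ⟨i.1, t⟩) '' P i := by
      rintro (t | ⟨i, t⟩) ht
      · exact Or.inl ⟨t, ht, rfl⟩
      · have ht' : h i t (ρ (hi i) x) ≠ h i t (ρ (lo i) x) := fun h => ht (by simp [h', h])
        refine Or.inr (mem_iUnion.2 ⟨⟨i, fun h => ht' (by rw [h])⟩, t, ?_, rfl⟩)
        by_contra hcon
        simp only [P, mem_union, mem_ofPred_eq, not_or, not_not] at hcon
        exact ht' (hcon.1.trans hcon.2.symm)
    refine (Cardinal.mk_le_mk_of_subset hsub).trans_lt ((Cardinal.mk_union_le _ _).trans_lt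
      (Cardinal.add_lt_of_lt hκ.le (Cardinal.mk_image_le.trans_lt (H₀.support x)) ?_))
    exact (Cardinal.card_iUnion_lt_iff_forall_of_isRegular hreg hJ).2
      fun i => Cardinal.mk_image_le.trans_lt (hP i)
  · intro x y hxy
    have h0 : f (ρ ∅ x) = f (ρ ∅ y) := H₀.separates x y fun t => hxy (Sum.inl t)
    have hstep (i : I) (hlo : f (ρ (lo i) x) = f (ρ (lo i) y)) :
        f (ρ (hi i) x) = f (ρ (hi i) y) := by
      have := (H i).separates (ρ (hi i) x) (ρ (hi i) y) fun t => by
        have h1 := hxy (Sum.inr ⟨i, t⟩)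
        have h2 := (H i).fibre t _ _ hlo
        simp only [h', Sum.elim_inr] at h1
        linarith
      rwa [hρ.comp_of_subset he.injective subset_rfl,
        hρ.comp_of_subset he.injective subset_rfl] at this
    -- A nonempty finite part of `w '' Q` lies in `hi m` for a largest index `m`, so zero, successor
    -- and limit stages are treated alike.
    have hlim (Q : Set I) (hQ : ∀ i ∈ Q, f (ρ (hi i) x) = f (ρ (hi i) y)) :
        f (ρ (w '' Q) x) = f (ρ (w '' Q) y) := by
      refine hρ.eq_of_forall_finset he hf fun F hF hFQ => ?_
      obtain ⟨G, hGQ, hGf, rfl⟩ := exists_subset_image_finite_and.1 ⟨F, hFQ, hF, rfl⟩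
      obtain rfl | hGne := G.eq_empty_or_nonempty
      · simpa using h0
      · obtain ⟨m, hm, hmax⟩ := hGf.exists_maximalFor id G hGne
        refine hρ.eq_of_subset he.injective (image_mono fun i hi' => ?_) (hQ m (hGQ hm))
        exact (le_total i m).elim id fun h => hmax hi' h
    have hall (i : I) : f (ρ (hi i) x) = f (ρ (hi i) y) := by
      induction i using WellFoundedLT.induction with
      | ind i ih => exact hstep i (hlim _ ih)
    have hX' : w '' univ = X := by
      ext s
      simp only [image_univ, mem_range, w]
      exact ⟨fun ⟨i, hi⟩ => hi ▸ (v i).2, fun hs => ⟨v.symm ⟨s, hs⟩, by simp⟩⟩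
    have := hlim univ fun i _ => hall i
    rwa [hX'] at this

lemma exists_isSeparatingFamily [CompactSpace K] (hκ : Cardinal.aleph0 < κ)
    (hreg : κ.IsRegular)
    (he : IsEmbedding e) (hsupp : ∀ x, Cardinal.mk (Function.support (e x)) < κ)
    (hf : Continuous f) (hsurj : Function.Surjective f)
    (hφ : ∀ F, Cardinal.mk (φ F) < κ) (hρ : IsFibreRetraction e f φ ρ) (X : Set S) :
    ∃ (T : Type u) (h : T → K → ℝ), IsSeparatingFamily κ f (ρ X) h := by
  induction X using (InvImage.wf (fun X : Set S => Cardinal.mk X) Cardinal.lt_wf).induction with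
  | h X ih =>
    rcases lt_or_ge (Cardinal.mk X) κ with hX | hX
    · exact exists_isSeparatingFamily_of_lt hκ hreg he hf hsurj hφ hρ hX
    · exact exists_isSeparatingFamily_of_forall_lt hκ hreg he hsupp hf hρ (hκ.le.trans hX) ih

end

/-! ### From a separating family to an embedding of `L` -/

lemma isCorsonCompact_of_isSeparatingFamily {K L T : Type u} [TopologicalSpace K] [CompactSpace K]
    [TopologicalSpace L] [T2Space L] {κ : Cardinal.{u}} (hκ : Cardinal.aleph0 < κ)
    {f : K → L} (hf : Continuous f) (hsurj : Function.Surjective f) {h : T → K → ℝ}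
    (H : IsSeparatingFamily κ f id h) : IsCorsonCompact κ L := by
  have hL : CompactSpace L := hsurj.compactSpace hf
  have hq : IsQuotientMap f := hf.isClosedMap.isQuotientMap hf hsurj
  let σ := Function.surjInv hsurj
  have hσ : ∀ y, f (σ y) = y := Function.surjInv_eq hsurj
  let clamp : ℝ → unitInterval := projIcc 0 1 zero_le_one
  have hclamp0 : clamp 0 = 0 := projIcc_left _
  have hclamp {a : ℝ} (ha : |a| ≤ 1) : a = clamp a - clamp (-a) := by
    have := abs_le.1 ha
    simp only [clamp, coe_projIcc]
    rcases le_total 0 a with h | h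
    · rw [min_eq_right this.2, max_eq_right h, min_eq_right (by linarith), max_eq_left (by linarith)]
      ring
    · rw [min_eq_right this.2, max_eq_left h, min_eq_right (by linarith), max_eq_right (by linarith)]
      ring
  -- Positive and negative parts give coordinates in `[0,1]` with no new support.
  let E : L → T ⊕ T → unitInterval := fun y =>
    Sum.elim (fun t => clamp (h t (σ y))) fun t => clamp (-h t (σ y))
  have hE (y : L) : E y ∈ sigmaProduct κ (T ⊕ T) := by
    have hsub : {t | E y t ≠ 0} ⊆
        Sum.inl '' {t | h t (σ y) ≠ 0} ∪ Sum.inr '' {t | h t (σ y) ≠ 0} := by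
      rintro (t | t) ht
      · exact Or.inl ⟨t, fun h0 => ht (by simp [E, h0, hclamp0]), rfl⟩
      · exact Or.inr ⟨t, fun h0 => ht (by simp [E, h0, hclamp0]), rfl⟩
    exact (Cardinal.mk_le_mk_of_subset hsub).trans_lt ((Cardinal.mk_union_le _ _).trans_lt
      (Cardinal.add_lt_of_lt hκ.le (Cardinal.mk_image_le.trans_lt (H.support _))
        (Cardinal.mk_image_le.trans_lt (H.support _))))
  have hcont (t : T) : Continuous fun y => h t (σ y) := by
    -- The section `σ` need not be continuous; constancy on fibres lets `h t` descend along the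
    -- quotient map `f`.
    rw [hq.continuous_iff]
    exact (H.continuous t).congr fun x => H.fibre t _ _ (hσ (f x)).symm
  have hEcont : Continuous E := by
    refine continuous_pi ?_
    rintro (t | t)
    · exact continuous_projIcc.comp (hcont t)
    · exact continuous_projIcc.comp (hcont t).neg
  refine ⟨hL, T ⊕ T, fun y => ⟨E y, hE y⟩,
    ((hEcont.subtype_mk hE).isClosedEmbedding fun y z hyz => ?_).isEmbedding⟩
  have hyz' : E y = E z := congrArg Subtype.val hyz
  have := H.separates (σ y) (σ z) fun t => by
    rw [hclamp (H.abs_le t (σ y)), hclamp (H.abs_le t (σ z))]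
    have h1 : clamp (h t (σ y)) = clamp (h t (σ z)) := congrFun hyz' (Sum.inl t)
    have h2 : clamp (-h t (σ y)) = clamp (-h t (σ z)) := congrFun hyz' (Sum.inr t)
    rw [h1, h2]
  simpa [hσ] using this

theorem mainTheorem2 (κ : Cardinal.{u}) (hκ : Cardinal.aleph0 < κ) (hreg : κ.IsRegular)
    (K L : Type u) [TopologicalSpace K] [TopologicalSpace L] [T2Space L]
    (hK : IsCorsonCompact κ K)
    (f : K → L) (hf : Continuous f) (hsurj : Function.Surjective f) :
    IsCorsonCompact κ L := by
  obtain ⟨hcomp, S, e, he⟩ := hK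
  have he' : IsEmbedding fun x => (e x).1 := IsEmbedding.subtypeVal.comp he
  have hsupp (x : K) : Cardinal.mk (Function.support (e x).1) < κ := (e x).2
  obtain ⟨φ, ρ, hφ, hρ⟩ := exists_isFibreRetraction hκ hreg he' hsupp hf
  obtain ⟨T, h, H⟩ := exists_isSeparatingFamily hκ hreg he' hsupp hf hsurj hφ hρ univ
  rw [show ρ univ = id from funext (hρ.univ_apply he'.injective)] at H
  exact isCorsonCompact_of_isSeparatingFamily hκ hf hsurj H
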